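/- **Proposition (Identification of the limit).** Let $G$ be a locally compact Hausdorff group, and let $\pi:G\to U(\mathcal H)$ be a strongly continuous irreducible unitary representation on a complex Hilbert space (inner products are linear in the first variable). Let $\mathcal H\otimes\mathcal H$ be the Hilbert tensor product and let $F$ be the flip, i.e. the bounded operator on $\mathcal H\otimes\mathcal H$ with $F(v\otimes w)=w\otimes v$. Let $S\subset G$ be a generating set (the smallest subgroup of $G$ containing $S$ is $G$). Let $(\mu_n)$ be a sequence of finite regular Borel measures on $G$ which are symmetric, i.e. $\mu_n(B^{-1})=\mu_n(B)$ for every Borel set $B$. Let $D\subset\mathcal H\otimes\mathcal H$ be a dense linear subspace with $(\pi(g)\otimes\pi(h))D\subset D$ for all $g,h\in G$. For a finite Borel measure $\mu$ on $G$, the operator $\int_G\pi(g)\otimes\pi(g^{-1})\,d\mu(g)\in B(\mathcal H\otimes\mathcal H)$ is understood in the weak sense. Put $$M_n=\int_G\pi(g)\otimes\pi(g^{-1})\,d\mu_n(g).$$ Assume that $M_n$ converges weakly on $D$ to a linear, a priori not necessarily bounded, operator $M:D\to\mathcal H\otimes\mathcal H$, that is, $\lim_{n\to\infty}\langle M_n\alpha,\beta\rangle=\langle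 M\alpha,\beta\rangle$ for all $\alpha,\beta\in D$. Assume also that for every $s\in S$ the operators $$\int_G\pi(g)\otimes\pi(g^{-1})\,d\mu_n(sg)-M_n\qquad\text{and}\qquad \int_G\pi(g)\otimes\pi(g^{-1})\,d\mu_n(gs)-M_n$$ converge weakly to $0$ on $D$, where $d\mu(sg)$ and $d\mu(gs)$ denote the measures $B\mapsto\mu(sB)$ and $B\mapsto\mu(Bs)$. Then $M$ is bounded, and there is a constant $c\in\mathbb C$ such that the unique continuous extension of $M$ to $\mathcal H\otimes\mathcal H$ is $c\cdot F$. Hence, for all $\alpha,\beta\in D$, $$\lim_{n\to\infty}\langle M_n\alpha,\beta\rangle=c\,\langle F\alpha,\beta\rangle .$$ In particular, for all $v,w,v',w'\in\mathcal H$ such that $w'\otimes v\in D$ and $v'\otimes w\in D$, $$\lim_{n\to\infty}\int_G\langle\pi(g)v,w\rangle\,\overline{\langle\pi(g)v',w'\rangle}\,d\mu_n(g)=c\,\langle v,v'\rangle\,\overline{\langle w,w'\rangle}.$$ -/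

import Mathlib

open MeasureTheory Filter Topology
open scoped TensorProduct ComplexConjugate

noncomputable section

namespace FlipLimit

/-- A (strongly continuous) unitary representation of a topological group `G` on `H`. -/
structure UnitaryRep (G H : Type*) [Group G] [TopologicalSpace G]
    [NormedAddCommGroup H] [InnerProductSpace ℂ H] [CompleteSpace H] where
  /-- the underlying homomorphism from `G` to the unitary group of `H` -/
  toHom : G →* unitary (H →L[ℂ] H)
  /-- strong continuity -/
  continuous_apply : ∀ v : H, Continuous fun g : G => (toHom g : H →L[ℂ] H) v

/-- The completed (Hilbert) tensor product `H ⊗ H`: the completion of the algebraic tensor product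
for the inner product with `⟪a ⊗ b, c ⊗ d⟫ = ⟪a, c⟫ * ⟪b, d⟫`. -/
abbrev HilbertTensor (H : Type*) [NormedAddCommGroup H] [InnerProductSpace ℂ H] : Type _ :=
  UniformSpace.Completion (H ⊗[ℂ] H)

section Tensor

variable {H : Type*} [NormedAddCommGroup H] [InnerProductSpace ℂ H]

/-- The elementary tensor `v ⊗ w` in the Hilbert tensor product. -/
def htmul (v w : H) : HilbertTensor H := ((v ⊗ₜ[ℂ] w : H ⊗[ℂ] H) : HilbertTensor H)

/-- The tensor product `A ⊗ B` of two bounded operators, on the Hilbert tensor product. -/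
def opTensor (A B : H →L[ℂ] H) : HilbertTensor H →L[ℂ] HilbertTensor H :=
  (TensorProduct.mapL A B).completion

variable (H) in
/-- The flip (symmetric braiding) `F (v ⊗ w) = w ⊗ v` on the Hilbert tensor product. -/
def flip : HilbertTensor H →L[ℂ] HilbertTensor H :=
  ((TensorProduct.commIsometry ℂ H H).toLinearIsometry.toContinuousLinearMap).completion

theorem opTensor_htmul (A B : H →L[ℂ] H) (v w : H) :
    opTensor A B (htmul v w) = htmul (A v) (B w) := by
  simp [opTensor, htmul]

theorem flip_htmul (v w : H) : flip H (htmul v w) = htmul w v := by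
  simp [flip, htmul]

theorem inner_htmul (a b c d : H) :
    inner ℂ (htmul a b) (htmul c d) = inner ℂ a c * inner ℂ b d := by
  simp [htmul]

theorem norm_opTensor_apply_le (A B : H →L[ℂ] H) (α : HilbertTensor H) :
    ‖opTensor A B α‖ ≤ ‖A‖ * ‖B‖ * ‖α‖ := by
  induction α using UniformSpace.Completion.induction_on with
  | hp => exact isClosed_le (by fun_prop) (by fun_prop)
  | ih x =>
    simp only [opTensor, ContinuousLinearMap.completion_apply_coe, UniformSpace.Completion.norm_coe]
    exact ((TensorProduct.mapL A B).le_opNorm x).trans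
      (mul_le_mul_of_nonneg_right (TensorProduct.norm_mapL_le A B) (norm_nonneg x))

end Tensor

namespace UnitaryRep

variable {G H : Type*} [Group G] [TopologicalSpace G]
  [NormedAddCommGroup H] [InnerProductSpace ℂ H] [CompleteSpace H] (π : UnitaryRep G H)

/-- The unitary operator `π(g)`, as a bounded operator. -/
def op (g : G) : H →L[ℂ] H := (π.toHom g : H →L[ℂ] H)

/-- Irreducibility: `H ≠ 0`, and the only closed `π(G)`-invariant subspaces are `0` and `H`. -/
def IsIrreducible : Prop :=
  Nontrivial H ∧ ∀ V : Submodule ℂ H, IsClosed (V : Set H) →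
    (∀ g : G, ∀ v ∈ V, π.op g v ∈ V) → V = ⊥ ∨ V = ⊤

/-- The operator `π(g) ⊗ π(h)` on the Hilbert tensor product. -/
def op₂ (g h : G) : HilbertTensor H →L[ℂ] HilbertTensor H := opTensor (π.op g) (π.op h)

theorem norm_op_apply (g : G) (v : H) : ‖π.op g v‖ = ‖v‖ := by
  have h := ContinuousLinearMap.inner_map_map_of_mem_unitary (π.toHom g).2 v v
  rw [@norm_eq_sqrt_re_inner ℂ, @norm_eq_sqrt_re_inner ℂ _ _ _ _ v]
  exact congrArg _ (congrArg _ h)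

theorem norm_op_le (g : G) : ‖π.op g‖ ≤ 1 :=
  ContinuousLinearMap.opNorm_le_bound _ zero_le_one fun v => by simp [norm_op_apply]

theorem norm_op₂_apply_le (g h : G) (α : HilbertTensor H) : ‖π.op₂ g h α‖ ≤ ‖α‖ := by
  refine (norm_opTensor_apply_le _ _ α).trans ?_
  have h1 := mul_le_one₀ (π.norm_op_le g) (norm_nonneg _) (π.norm_op_le h)
  simpa using mul_le_mul_of_nonneg_right h1 (norm_nonneg α)

theorem continuous_op₂_coe (x : H ⊗[ℂ] H) :
    Continuous fun p : G × G => π.op₂ p.1 p.2 (x : HilbertTensor H) := by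
  induction x with
  | zero =>
    simp only [UniformSpace.Completion.coe_zero, map_zero]
    exact continuous_const
  | tmul v w =>
    have h : (fun p : G × G => π.op₂ p.1 p.2 ((v ⊗ₜ[ℂ] w : H ⊗[ℂ] H) : HilbertTensor H)) =
        fun p : G × G => ((π.op p.1 v ⊗ₜ[ℂ] π.op p.2 w : H ⊗[ℂ] H) : HilbertTensor H) := by
      funext p
      exact opTensor_htmul _ _ _ _
    rw [h]
    have h1 : Continuous fun p : G × G => (π.op p.1 v, π.op p.2 w) :=
      ((π.continuous_apply v).comp continuous_fst).prodMk
        ((π.continuous_apply w).comp continuous_snd)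
    have h2 : Continuous fun p : H × H => p.1 ⊗ₜ[ℂ] p.2 := TensorProduct.continuous_tmul
    exact (UniformSpace.Completion.continuous_coe (H ⊗[ℂ] H)).comp (h2.comp h1)
  | add x y hx hy =>
    simp only [UniformSpace.Completion.coe_add, map_add]
    exact hx.add hy

theorem continuous_op₂ (α : HilbertTensor H) :
    Continuous fun p : G × G => π.op₂ p.1 p.2 α := by
  refine continuous_iff_continuousAt.2 fun p => ?_
  rw [Metric.continuousAt_iff']
  intro ε hε
  obtain ⟨x, hx⟩ : ∃ x : H ⊗[ℂ] H, dist α (x : HilbertTensor H) < ε / 3 := by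
    obtain ⟨_, hy, x, rfl⟩ := Metric.dense_iff.1
      (UniformSpace.Completion.denseRange_coe (α := H ⊗[ℂ] H)) α (ε / 3) (by positivity)
    exact ⟨x, by rw [dist_comm]; exact hy⟩
  have hc := Metric.continuousAt_iff'.1 ((π.continuous_op₂_coe x).continuousAt (x := p)) (ε / 3)
    (by positivity)
  have key : ∀ q : G × G,
      dist (π.op₂ q.1 q.2 α) (π.op₂ q.1 q.2 (x : HilbertTensor H)) < ε / 3 := by
    intro q
    rw [dist_eq_norm, ← map_sub]
    exact (π.norm_op₂_apply_le _ _ _).trans_lt (by rwa [← dist_eq_norm])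
  filter_upwards [hc] with q hq
  have h1 := dist_triangle4 (π.op₂ q.1 q.2 α) (π.op₂ q.1 q.2 (x : HilbertTensor H))
    (π.op₂ p.1 p.2 (x : HilbertTensor H)) (π.op₂ p.1 p.2 α)
  have h2 := key q
  have h3 := key p
  rw [dist_comm] at h3
  linarith

section Average

variable [IsTopologicalGroup G] [MeasurableSpace G] [BorelSpace G]
  (μ : Measure G) [IsFiniteMeasure μ]

theorem integrable_inner_op₂ (α β : HilbertTensor H) :
    Integrable (fun g : G => inner ℂ (π.op₂ g g⁻¹ α) β) μ := by
  have hc : Continuous fun g : G => inner ℂ (π.op₂ g g⁻¹ α) β :=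
    ((π.continuous_op₂ α).comp (continuous_id.prodMk continuous_inv)).inner continuous_const
  refine Integrable.of_bound hc.measurable.aestronglyMeasurable (‖α‖ * ‖β‖) (.of_forall fun g => ?_)
  exact (norm_inner_le_norm _ _).trans
    (mul_le_mul_of_nonneg_right (π.norm_op₂_apply_le _ _ _) (norm_nonneg _))

/-- The bounded sesquilinear form `(α, β) ↦ ∫ ⟪(π(g) ⊗ π(g⁻¹)) α, β⟫ dμ(g)`
(conjugate-linear in `α`, following Mathlib's convention for inner products). -/
def averageForm : HilbertTensor H →L⋆[ℂ] HilbertTensor H →L[ℂ] ℂ :=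
  LinearMap.mkContinuous₂
    (LinearMap.mk₂'ₛₗ (starRingEnd ℂ) (RingHom.id ℂ)
      (fun α β => ∫ g, inner ℂ (π.op₂ g g⁻¹ α) β ∂μ)
      (fun α α' β => by
        simp only [map_add, inner_add_left]
        exact integral_add (π.integrable_inner_op₂ μ α β) (π.integrable_inner_op₂ μ α' β))
      (fun c α β => by
        simp only [map_smul, inner_smul_left, smul_eq_mul]
        exact integral_const_mul _ _)
      (fun α β β' => by
        simp only [inner_add_right]
        exact integral_add (π.integrable_inner_op₂ μ α β) (π.integrable_inner_op₂ μ α β'))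
      (fun c α β => by
        simp only [inner_smul_right, smul_eq_mul, RingHom.id_apply]
        exact integral_const_mul _ _))
    (μ.real Set.univ) (fun α β => by
      have h := norm_integral_le_of_norm_le_const (μ := μ)
        (f := fun g : G => inner ℂ (π.op₂ g g⁻¹ α) β) (C := ‖α‖ * ‖β‖)
        (.of_forall fun g => (norm_inner_le_norm _ _).trans
          (mul_le_mul_of_nonneg_right (π.norm_op₂_apply_le _ _ _) (norm_nonneg _)))
      exact h.trans_eq (by ring))

/-- The operator `∫ π(g) ⊗ π(g⁻¹) dμ(g)`: the bounded operator `T` on the Hilbert tensor product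
with `⟪T α, β⟫ = ∫ ⟪(π(g) ⊗ π(g⁻¹)) α, β⟫ dμ(g)` for all `α, β`. -/
def average : HilbertTensor H →L[ℂ] HilbertTensor H :=
  InnerProductSpace.continuousLinearMapOfBilin (π.averageForm μ)

theorem inner_average (α β : HilbertTensor H) :
    inner ℂ (π.average μ α) β = ∫ g, inner ℂ (π.op₂ g g⁻¹ α) β ∂μ := by
  rw [average, InnerProductSpace.continuousLinearMapOfBilin_apply]
  rfl

end Average

end UnitaryRep

section Measures

variable {G : Type*} [Group G] [MeasurableSpace G]

/-- `μ` is symmetric: `μ(B⁻¹) = μ(B)` for every Borel set `B`. -/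
def IsSymmetric (μ : Measure G) : Prop := ∀ B : Set G, MeasurableSet B → μ B⁻¹ = μ B

/-- The measure `dμ(sg)`, that is `B ↦ μ(sB)`. -/
abbrev leftTranslate (μ : Measure G) (s : G) : Measure G := μ.map fun g => s⁻¹ * g

/-- The measure `dμ(gs)`, that is `B ↦ μ(Bs)`. -/
abbrev rightTranslate (μ : Measure G) (s : G) : Measure G := μ.map fun g => g * s⁻¹

theorem leftTranslate_apply [MeasurableMul G] (μ : Measure G) (s : G) {B : Set G}
    (hB : MeasurableSet B) : leftTranslate μ s B = μ ((fun g => s * g) '' B) := by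
  rw [leftTranslate, Measure.map_apply (measurable_const_mul _) hB, Set.image_mul_left]

theorem rightTranslate_apply [MeasurableMul G] (μ : Measure G) (s : G) {B : Set G}
    (hB : MeasurableSet B) : rightTranslate μ s B = μ ((fun g => g * s) '' B) := by
  rw [rightTranslate, Measure.map_apply (measurable_mul_const _) hB, Set.image_mul_right]

end Measures

/-- The sequence of operators `T n` converges weakly to `0` on the subspace `D`. -/
def WeaklyTendstoZeroOn {K : Type*} [NormedAddCommGroup K] [InnerProductSpace ℂ K]
    (D : Submodule ℂ K) (T : ℕ → K →L[ℂ] K) : Prop :=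
  ∀ α ∈ D, ∀ β ∈ D, Tendsto (fun n => inner ℂ (T n α) β) atTop (𝓝 0)

/-- The sequence of bounded operators `T n` converges weakly, on the subspace `D`, to the (possibly
unbounded) operator `M` with domain `D`. -/
def WeaklyTendstoOn {K : Type*} [NormedAddCommGroup K] [InnerProductSpace ℂ K]
    (D : Submodule ℂ K) (T : ℕ → K →L[ℂ] K) (M : D →ₗ[ℂ] K) : Prop :=
  ∀ α β : D, Tendsto (fun n => inner ℂ (T n α) (β : K)) atTop (𝓝 (inner ℂ (M α) (β : K)))

end FlipLimit

end

/-! The substitution `g ↦ s⁻¹g` turns `π(g) ⊗ π(g⁻¹)` into `(π(s⁻¹) ⊗ 1)(π(g) ⊗ π(g⁻¹))(1 ⊗ π(s))`,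
so asymptotic left invariance gives `M(1 ⊗ π(s)) = (π(s) ⊗ 1)M` on `D`; right invariance is similar.
The pairs `(g, h)` with `M(π(g) ⊗ π(h)) = (π(h) ⊗ π(g))M` form a subgroup, hence all of `G × G`, and
`FM` commutes with every `π(g) ⊗ π(h)`.

Schur's lemma should make `FM` scalar, but `M` may be unbounded. Symmetry of the measures makes `M`
symmetric, so `FM` is contained in the closed operator `FM*`. The orthogonal projection onto the
graph of `FM*` is bounded and invariant, so its matrix entries lie in the commutant of `π ⊗ π`,
which is trivial by `exists_eq_smul_one_op₂`. Hence the graph lies in that of a scalar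
(`exists_eq_smul_of_mem_graph`), and boundedness of `M` is a by-product. -/

noncomputable section

namespace FlipLimit

/-! ### Schur's lemma for bounded and for closed operators. -/

section Schur

/-- A self-adjoint operator which commutes with a family of operators leaving no proper nonzero closed
subspace invariant is scalar. -/
theorem exists_eq_smul_one_of_isSelfAdjoint {ι H : Type*} [NormedAddCommGroup H]
    [InnerProductSpace ℂ H] [CompleteSpace H] [Nontrivial H] (U : ι → H →L[ℂ] H)
    (hU : ∀ V : Submodule ℂ H, IsClosed (V : Set H) → (∀ i, ∀ v ∈ V, U i v ∈ V) → V = ⊥ ∨ V = ⊤)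
    (a : H →L[ℂ] H) (ha : IsSelfAdjoint a) (hc : ∀ i, Commute a (U i)) :
    ∃ c : ℂ, a = c • (1 : H →L[ℂ] H) := by
  have hsub : (spectrum ℝ a).Subsingleton := by
    intro x hx y hy
    by_contra hxy
    wlog hlt : x < y generalizing x y
    · exact this hy hx (Ne.symm hxy) (lt_of_le_of_ne (not_lt.1 hlt) (Ne.symm hxy))
    -- Two spectral points would be separated by `f` and `g`, which have product zero. The kernel of
    -- `cfc f a` is then closed and invariant, contains the nonzero range of `cfc g a`, and is not
    -- everything.
    set m := (x + y) / 2 with hm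
    set f : ℝ → ℝ := fun t => max (m - t) 0
    set g : ℝ → ℝ := fun t => max (t - m) 0
    have hf : Continuous f := by fun_prop
    have hg : Continuous g := by fun_prop
    have hfg : cfc f a * cfc g a = 0 := by
      rw [← cfc_mul f g a hf.continuousOn hg.continuousOn]
      have : (fun t => f t * g t) = fun _ => 0 := by
        funext t
        rcases le_total t m with h | h
        · simp [g, h]
        · simp [f, h]
      rw [this, cfc_const_zero]
    have hne (k : ℝ → ℝ) (hk : Continuous k) (t : ℝ) (ht : t ∈ spectrum ℝ a) (hkt : k t ≠ 0) :
        cfc k a ≠ 0 := by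
      intro h0
      have hs := cfc_map_spectrum k a ha hk.continuousOn
      rw [h0, spectrum.zero_eq] at hs
      exact hkt (by simpa using hs.ge ⟨t, ht, rfl⟩)
    have hf0 := hne f hf x hx (by simp [f, hm]; linarith)
    have hg0 := hne g hg y hy (by simp [g, hm]; linarith)
    have hcf (i : ι) : Commute (cfc f a) (U i) := (hc i).cfc_real f
    rcases hU (LinearMap.ker (cfc f a).toLinearMap) (ContinuousLinearMap.isClosed_ker _)
      (fun i v hv => by
        have h1 := DFunLike.congr_fun (hcf i).eq v
        simp only [LinearMap.mem_ker, ContinuousLinearMap.coe_coe] at hv ⊢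
        simpa [hv] using h1) with h | h
    · apply hg0
      ext v
      have h1 : cfc g a v ∈ LinearMap.ker (cfc f a).toLinearMap := by
        simpa using DFunLike.congr_fun hfg v
      simpa [h] using h1
    · apply hf0
      ext v
      have h1 : v ∈ LinearMap.ker (cfc f a).toLinearMap := h ▸ Submodule.mem_top
      simpa using h1
  obtain ⟨r, hr⟩ := ContinuousFunctionalCalculus.spectrum_nonempty (R := ℝ) a ha
  refine ⟨r, ?_⟩
  have h1 : cfc (id : ℝ → ℝ) a = cfc (fun _ => r) a := cfc_congr fun t ht => hsub ht hr
  rw [cfc_id ℝ a, cfc_const r a] at h1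
  rw [h1]
  ext v
  simp [Algebra.algebraMap_eq_smul_one]

/-- **Schur's lemma** for a family of operators on a Hilbert space which is closed under adjoints and
leaves no proper nonzero closed subspace invariant. -/
theorem exists_eq_smul_one_of_commute {ι H : Type*} [NormedAddCommGroup H]
    [InnerProductSpace ℂ H] [CompleteSpace H] [Nontrivial H] (U : ι → H →L[ℂ] H)
    (hstar : ∀ i, ∃ j, star (U i) = U j)
    (hU : ∀ V : Submodule ℂ H, IsClosed (V : Set H) → (∀ i, ∀ v ∈ V, U i v ∈ V) → V = ⊥ ∨ V = ⊤)
    (a : H →L[ℂ] H) (hc : ∀ i, Commute a (U i)) :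
    ∃ c : ℂ, a = c • (1 : H →L[ℂ] H) := by
  have hc' (i : ι) : Commute (star a) (U i) := by
    obtain ⟨j, hj⟩ := hstar i
    have := (hc j).star_star
    rwa [← hj, star_star] at this
  obtain ⟨x, hx⟩ := exists_eq_smul_one_of_isSelfAdjoint U hU (realPart a) (realPart a).2 fun i => by
    rw [realPart_apply_coe]
    exact ((hc i).add_left (hc' i)).smul_left _
  obtain ⟨y, hy⟩ := exists_eq_smul_one_of_isSelfAdjoint U hU (imaginaryPart a) (imaginaryPart a).2
    fun i => by
      rw [imaginaryPart_apply_coe]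
      exact (((hc i).sub_left (hc' i)).smul_left _).smul_left _
  refine ⟨x + Complex.I * y, ?_⟩
  rw [← realPart_add_I_smul_imaginaryPart a, hx, hy, smul_smul, add_smul]

/-- Schur's lemma for closed operators, in terms of the graph: a closed invariant subspace of
`K × K` which is the graph of a partially defined operator is contained in the graph of a scalar. -/
theorem exists_eq_smul_of_mem_graph {ι K : Type*} [NormedAddCommGroup K]
    [InnerProductSpace ℂ K] [CompleteSpace K] (U : ι → K →L[ℂ] K)
    (hstar : ∀ i, ∃ j, star (U i) = U j)
    (hU : ∀ a : K →L[ℂ] K, (∀ i, Commute a (U i)) → ∃ c : ℂ, a = c • (1 : K →L[ℂ] K))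
    (Γ : Submodule ℂ (WithLp 2 (K × K))) (hΓ : IsClosed (Γ : Set (WithLp 2 (K × K))))
    (hinv : ∀ i x y, WithLp.toLp 2 (x, y) ∈ Γ → WithLp.toLp 2 (U i x, U i y) ∈ Γ)
    (hgraph : ∀ y, WithLp.toLp 2 (0, y) ∈ Γ → y = 0) :
    ∃ c : ℂ, ∀ x y, WithLp.toLp 2 (x, y) ∈ Γ → y = c • x := by
  have : CompleteSpace Γ := hΓ.completeSpace_coe
  set P := Γ.starProjection with hP
  -- `P` commutes with `U i ⊕ U i`: closure under adjoints makes the orthogonal complement of `Γ`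
  -- invariant too.
  have hPU (i : ι) (x y : K) : P (WithLp.toLp 2 (U i x, U i y)) =
      WithLp.toLp 2 (U i (P (WithLp.toLp 2 (x, y))).fst, U i (P (WithLp.toLp 2 (x, y))).snd) := by
    refine Submodule.eq_starProjection_of_mem_of_inner_eq_zero
      (hinv i _ _ (Γ.starProjection_apply_mem (WithLp.toLp 2 (x, y)))) fun w hw => ?_
    obtain ⟨j, hj⟩ := hstar i
    have h1 := Γ.starProjection_inner_eq_zero (WithLp.toLp 2 (x, y)) _ (hinv j w.fst w.snd hw)
    rw [WithLp.prod_inner_apply] at h1 ⊢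
    simpa [← hj, ContinuousLinearMap.star_eq_adjoint, ContinuousLinearMap.adjoint_inner_right]
      using h1
  set e : K × K →L[ℂ] WithLp 2 (K × K) :=
    ((WithLp.prodContinuousLinearEquiv 2 ℂ K K).symm : K × K →L[ℂ] WithLp 2 (K × K)) with he
  have he' (z : K × K) : e z = WithLp.toLp 2 z := rfl
  set inl := e ∘L ContinuousLinearMap.inl ℂ K K
  set inr := e ∘L ContinuousLinearMap.inr ℂ K K
  set fst := WithLp.fstL 2 ℂ K K
  set snd := WithLp.sndL 2 ℂ K K
  have hl (i : ι) (x : K) : P (inl (U i x)) =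
      WithLp.toLp 2 (U i (P (inl x)).fst, U i (P (inl x)).snd) := by
    simpa [inl, he'] using hPU i x 0
  have hr (i : ι) (x : K) : P (inr (U i x)) =
      WithLp.toLp 2 (U i (P (inr x)).fst, U i (P (inr x)).snd) := by
    simpa [inr, he'] using hPU i 0 x
  -- Three of the four block entries of `P` suffice.
  obtain ⟨a, ha⟩ := hU (fst ∘L P ∘L inl) fun i => by
    ext x
    simp [hl, fst]
  obtain ⟨b, hb⟩ := hU (fst ∘L P ∘L inr) fun i => by
    ext x
    simp [hr, fst]
  obtain ⟨c, hc⟩ := hU (snd ∘L P ∘L inl) fun i => by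
    ext x
    simp [hl, snd]
  have ha' (x : K) : (P (inl x)).fst = a • x := DFunLike.congr_fun ha x
  have hb' (x : K) : (P (inr x)).fst = b • x := DFunLike.congr_fun hb x
  have hc' (x : K) : (P (inl x)).snd = c • x := DFunLike.congr_fun hc x
  have hsum (x y : K) : WithLp.toLp 2 (x, y) = inl x + inr y := by
    simp [inl, inr, he', ← WithLp.toLp_add]
  have hmem (x y : K) (h : WithLp.toLp 2 (x, y) ∈ Γ) : x = a • x + b • y := by
    have h1 := congrArg WithLp.fst (Submodule.starProjection_eq_self_iff.2 h)
    rw [← hP, hsum, map_add, WithLp.add_fst, ha', hb', ← hsum] at h1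
    exact h1.symm
  -- If `b ≠ 0`, the relation `x = a • x + b • y` determines `y`. If `b = 0` and `a = 1`, every `(x,
  -- c • x)` lies in `Γ`, and a graph has only one value over `x`. Otherwise `x = 0`.
  by_cases hb0 : b = 0
  · by_cases ha1 : a = 1
    · refine ⟨c, fun x y h => ?_⟩
      have h1 : WithLp.toLp 2 (x, c • x) ∈ Γ := by
        have h2 : P (inl x) = WithLp.toLp 2 (x, c • x) := by
          apply WithLp.ofLp_injective
          exact Prod.ext ((ha' x).trans (by simp [ha1])) (hc' x)
        exact h2 ▸ Γ.starProjection_apply_mem _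
      have h2 := Γ.sub_mem h h1
      rw [← WithLp.toLp_sub, Prod.mk_sub_mk, sub_self] at h2
      exact sub_eq_zero.1 (hgraph _ h2)
    · refine ⟨0, fun x y h => ?_⟩
      have h1 := hmem x y h
      have hx : x = 0 := by
        have h2 : (1 - a) • x = 0 := by
          rw [sub_smul, one_smul, sub_eq_zero]
          simpa [hb0] using h1
        exact (smul_eq_zero.1 h2).resolve_left (sub_ne_zero.2 (Ne.symm ha1))
      subst hx
      simpa using hgraph y h
  · refine ⟨b⁻¹ * (1 - a), fun x y h => ?_⟩
    have h1 : b • y = (1 - a) • x := by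
      rw [sub_smul, one_smul]
      exact eq_sub_of_add_eq' (hmem x y h).symm
    rw [mul_smul, ← h1, inv_smul_smul₀ hb0]

end Schur

/-! ### Elementary tensors and the flip. -/

section Tensor

variable {H : Type*} [NormedAddCommGroup H] [InnerProductSpace ℂ H]

theorem continuousLinearMap_ext_htmul {E : Type*} [NormedAddCommGroup E] [NormedSpace ℂ E]
    {S T : HilbertTensor H →L[ℂ] E} (h : ∀ v w, S (htmul v w) = T (htmul v w)) : S = T := by
  ext α
  induction α using UniformSpace.Completion.induction_on with
  | hp => exact isClosed_eq S.continuous T.continuous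
  | ih x =>
    induction x with
    | zero => exact (map_zero S).trans (map_zero T).symm
    | tmul v w => exact h v w
    | add x y hx hy => rw [UniformSpace.Completion.coe_add, map_add, map_add, hx, hy]

theorem ext_inner_htmul {x y : HilbertTensor H}
    (h : ∀ v w, inner ℂ x (htmul v w) = inner ℂ y (htmul v w)) : x = y := by
  refine ext_inner_right ℂ fun α => ?_
  exact DFunLike.congr_fun (continuousLinearMap_ext_htmul (S := innerSL ℂ x) (T := innerSL ℂ y) h) α

variable (H) in
/-- The elementary tensor `htmul`, as a continuous bilinear map. -/
def htmulL : H →L[ℂ] H →L[ℂ] HilbertTensor H :=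
  (ContinuousLinearMap.compL ℂ H (H ⊗[ℂ] H) (HilbertTensor H)
    UniformSpace.Completion.toComplL) ∘L TensorProduct.mkL ℂ H H

theorem htmulL_apply (v w : H) : htmulL H v w = htmul v w := rfl

theorem flip_flip (α : HilbertTensor H) : flip H (flip H α) = α := by
  have h : flip H ∘L flip H = ContinuousLinearMap.id ℂ _ :=
    continuousLinearMap_ext_htmul fun v w => by simp [flip_htmul]
  exact DFunLike.congr_fun h α

theorem flip_opTensor (A B : H →L[ℂ] H) (α : HilbertTensor H) :
    flip H (opTensor A B α) = opTensor B A (flip H α) := by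
  have h : flip H ∘L opTensor A B = opTensor B A ∘L flip H :=
    continuousLinearMap_ext_htmul fun v w => by simp [flip_htmul, opTensor_htmul]
  exact DFunLike.congr_fun h α

end Tensor

/-! ### Algebra of `π(g) ⊗ π(h)` and its commutant. -/

namespace UnitaryRep

variable {G H : Type*} [Group G] [TopologicalSpace G]
  [NormedAddCommGroup H] [InnerProductSpace ℂ H] [CompleteSpace H] (π : UnitaryRep G H)

theorem op_mul (g h : G) : π.op (g * h) = π.op g * π.op h := by simp [op]

theorem op_one : π.op 1 = 1 := by simp [op]

theorem star_op (g : G) : star (π.op g) = π.op g⁻¹ := by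
  simp [op, ← Unitary.coe_star, Unitary.star_eq_inv]

theorem inner_op_left (g : G) (v w : H) : inner ℂ (π.op g v) w = inner ℂ v (π.op g⁻¹ w) := by
  rw [← star_op, ContinuousLinearMap.star_eq_adjoint, ContinuousLinearMap.adjoint_inner_right]

theorem op₂_htmul (g h : G) (v w : H) : π.op₂ g h (htmul v w) = htmul (π.op g v) (π.op h w) :=
  opTensor_htmul _ _ _ _

theorem op₂_op₂ (g h g' h' : G) (α : HilbertTensor H) :
    π.op₂ g h (π.op₂ g' h' α) = π.op₂ (g * g') (h * h') α := by
  have h : π.op₂ g h ∘L π.op₂ g' h' = π.op₂ (g * g') (h * h') :=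
    continuousLinearMap_ext_htmul fun v w => by simp [op₂_htmul, op_mul]
  exact DFunLike.congr_fun h α

theorem op₂_one_one (α : HilbertTensor H) : π.op₂ 1 1 α = α := by
  have h : π.op₂ 1 1 = ContinuousLinearMap.id ℂ _ :=
    continuousLinearMap_ext_htmul fun v w => by simp [op₂_htmul, op_one]
  exact DFunLike.congr_fun h α

theorem flip_op₂ (g h : G) (α : HilbertTensor H) :
    flip H (π.op₂ g h α) = π.op₂ h g (flip H α) :=
  flip_opTensor _ _ _

theorem star_op₂ (g h : G) : star (π.op₂ g h) = π.op₂ g⁻¹ h⁻¹ := by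
  refine continuousLinearMap_ext_htmul fun v w => ext_inner_htmul fun v' w' => ?_
  rw [ContinuousLinearMap.star_eq_adjoint, ContinuousLinearMap.adjoint_inner_left, op₂_htmul,
    op₂_htmul, inner_htmul, inner_htmul, inner_op_left, inner_op_left, inv_inv, inv_inv]

theorem inner_op₂_left (g h : G) (α β : HilbertTensor H) :
    inner ℂ (π.op₂ g h α) β = inner ℂ α (π.op₂ g⁻¹ h⁻¹ β) := by
  rw [← star_op₂, ContinuousLinearMap.star_eq_adjoint, ContinuousLinearMap.adjoint_inner_right]

variable {π}

/-- **Schur's lemma** for irreducible unitary representations. -/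
theorem IsIrreducible.exists_eq_smul_one (hπ : π.IsIrreducible) (a : H →L[ℂ] H)
    (ha : ∀ g, Commute a (π.op g)) : ∃ c : ℂ, a = c • (1 : H →L[ℂ] H) := by
  have := hπ.1
  exact exists_eq_smul_one_of_commute π.op (fun g => ⟨g⁻¹, π.star_op g⟩) hπ.2 a ha

/-- The commutant of the exterior tensor square of an irreducible representation is trivial. -/
theorem IsIrreducible.exists_eq_smul_one_op₂ (hπ : π.IsIrreducible)
    (T : HilbertTensor H →L[ℂ] HilbertTensor H)
    (hT : ∀ p : G × G, Commute T (π.op₂ p.1 p.2)) :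
    ∃ c : ℂ, T = c • (1 : HilbertTensor H →L[ℂ] HilbertTensor H) := by
  have hT' (g h : G) (α : HilbertTensor H) : T (π.op₂ g h α) = π.op₂ g h (T α) :=
    DFunLike.congr_fun (hT (g, h)).eq α
  -- Fixing one tensor factor on each side compresses `T` to the operator `B* T A` on `H`, which
  -- commutes with `π` and is therefore scalar. It is used with `k g` equal to `π(g) ⊗ 1` and `1 ⊗
  -- π(g)`.
  have slice (A B : H →L[ℂ] HilbertTensor H) (k : G → HilbertTensor H →L[ℂ] HilbertTensor H)
      (hk : ∀ g α, T (k g α) = k g (T α))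
      (hks : ∀ g α β, inner ℂ (k g α) β = inner ℂ α (k g⁻¹ β))
      (hA : ∀ g v, A (π.op g v) = k g (A v)) (hB : ∀ g v, B (π.op g v) = k g (B v)) :
      ∃ c : ℂ, ∀ v v', inner ℂ (T (A v)) (B v') = c * inner ℂ v v' := by
    obtain ⟨c, hc⟩ := hπ.exists_eq_smul_one (ContinuousLinearMap.adjoint B ∘L T ∘L A) fun g => by
      ext v
      refine ext_inner_right ℂ fun v' => ?_
      simp [ContinuousLinearMap.adjoint_inner_left, inner_op_left, hA, hB, hk, hks]
    refine ⟨conj c, fun v v' => ?_⟩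
    have h1 := congrArg (fun x => inner ℂ x v') (DFunLike.congr_fun hc v)
    simpa [ContinuousLinearMap.adjoint_inner_left, inner_smul_left, mul_comm] using h1
  have h1 (w w' : H) : ∃ c : ℂ, ∀ v v',
      inner ℂ (T (htmul v w)) (htmul v' w') = c * inner ℂ v v' :=
    slice ((htmulL H).flip w) ((htmulL H).flip w') (fun g => π.op₂ g 1) (fun g α => hT' _ _ _)
      (fun g α β => by simp [inner_op₂_left])
      (fun g v => by simp [htmulL_apply, op₂_htmul, op_one])
      (fun g v => by simp [htmulL_apply, op₂_htmul, op_one])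
  have h2 (v v' : H) : ∃ c : ℂ, ∀ w w',
      inner ℂ (T (htmul v w)) (htmul v' w') = c * inner ℂ w w' :=
    slice (htmulL H v) (htmulL H v') (fun g => π.op₂ 1 g) (fun g α => hT' _ _ _)
      (fun g α β => by simp [inner_op₂_left])
      (fun g v => by simp [htmulL_apply, op₂_htmul, op_one])
      (fun g v => by simp [htmulL_apply, op₂_htmul, op_one])
  have := hπ.1
  obtain ⟨e, he⟩ := exists_ne (0 : H)
  have he' : inner ℂ e e ≠ 0 := inner_self_ne_zero.2 he
  -- Evaluating both slice formulas at `v = v' = e` shows that the constant for `w, w'` is a fixed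
  -- multiple of their inner product. The conjugate below reflects conjugate-linearity in the first
  -- variable.
  obtain ⟨d, hd⟩ := h2 e e
  refine ⟨conj (d / inner ℂ e e), continuousLinearMap_ext_htmul fun v w =>
    ext_inner_htmul fun v' w' => ?_⟩
  obtain ⟨c, hc⟩ := h1 w w'
  have h3 : c = d * inner ℂ w w' / inner ℂ e e := by
    rw [eq_div_iff he', ← hc, hd]
  rw [hc, h3]
  simp only [smul_apply, one_apply_eq_self, inner_smul_left,
    Complex.conj_conj, inner_htmul]
  ring

end UnitaryRep

end FlipLimit

namespace FlipLimit

/-! ### Translation and inversion of the averaged operators. -/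

section Average

variable {G H : Type*} [Group G] [TopologicalSpace G] [IsTopologicalGroup G] [MeasurableSpace G]
  [BorelSpace G] [NormedAddCommGroup H] [InnerProductSpace ℂ H] [CompleteSpace H]
  (π : UnitaryRep G H)

theorem measurable_inner_op₂_inv (α β : HilbertTensor H) :
    Measurable fun g : G => inner ℂ (π.op₂ g g⁻¹ α) β :=
  (((π.continuous_op₂ α).comp (continuous_id.prodMk continuous_inv)).inner
    continuous_const).measurable

/-- Change variables and factor the integrand; the outer factor `π(s⁻¹) ⊗ 1` moves to `β` as its
adjoint. -/
theorem inner_average_leftTranslate (μ : Measure G) [IsFiniteMeasure μ] (s : G)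
    (α β : HilbertTensor H) :
    inner ℂ (π.average (leftTranslate μ s) α) β =
      inner ℂ (π.average μ (π.op₂ 1 s α)) (π.op₂ s 1 β) := by
  rw [π.inner_average, π.inner_average, integral_map (measurable_const_mul _).aemeasurable
    (measurable_inner_op₂_inv π α β).aestronglyMeasurable]
  congr 1 with g
  rw [← inv_inv s, ← inv_one, ← π.inner_op₂_left, π.op₂_op₂, π.op₂_op₂]
  simp

theorem inner_average_rightTranslate (μ : Measure G) [IsFiniteMeasure μ] (s : G)
    (α β : HilbertTensor H) :
    inner ℂ (π.average (rightTranslate μ s) α) β =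
      inner ℂ (π.average μ (π.op₂ s⁻¹ 1 α)) (π.op₂ 1 s⁻¹ β) := by
  rw [π.inner_average, π.inner_average, integral_map (measurable_mul_const _).aemeasurable
    (measurable_inner_op₂_inv π α β).aestronglyMeasurable]
  congr 1 with g
  rw [← inv_one, ← π.inner_op₂_left, π.op₂_op₂, π.op₂_op₂]
  simp

theorem IsSymmetric.integral_inv {μ : Measure G} (hμ : IsSymmetric μ) {E : Type*}
    [NormedAddCommGroup E] [NormedSpace ℝ E] (f : G → E) :
    ∫ g, f g⁻¹ ∂μ = ∫ g, f g ∂μ := by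
  have h : MeasurePreserving (MeasurableEquiv.inv G) μ μ := by
    refine ⟨measurable_inv, Measure.ext fun B hB => ?_⟩
    rw [MeasurableEquiv.map_apply]
    exact hμ B hB
  exact h.integral_comp' f

/-- The adjoint of `π(g) ⊗ π(g⁻¹)` is the same expression at `g⁻¹`, and `μ` is invariant under
inversion. -/
theorem inner_average_left {μ : Measure G} [IsFiniteMeasure μ] (hμ : IsSymmetric μ)
    (α β : HilbertTensor H) :
    inner ℂ (π.average μ α) β = inner ℂ α (π.average μ β) := by
  rw [← inner_conj_symm α, π.inner_average, π.inner_average, ← integral_conj, ← hμ.integral_inv]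
  congr 1 with g
  rw [inner_conj_symm, π.inner_op₂_left, inv_inv]

/-- Translates the operator limit into matrix coefficients. After inverting `g`, the integrand
splits as the inner product of two elementary tensors. -/
theorem integral_inner_mul_conj_inner {μ : Measure G} [IsFiniteMeasure μ] (hμ : IsSymmetric μ)
    (v w v' w' : H) :
    ∫ g, inner ℂ w (π.op g v) * conj (inner ℂ w' (π.op g v')) ∂μ =
      conj (inner ℂ (π.average μ (htmul w' v)) (htmul v' w)) := by
  rw [π.inner_average, ← integral_conj, ← hμ.integral_inv]
  congr 1 with g
  rw [π.op₂_htmul, inner_htmul]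
  simp only [map_mul, inner_conj_symm]
  rw [π.inner_op_left g⁻¹ v', inv_inv, mul_comm]

end Average

/-! ### Symmetry and intertwining pass to the weak limit. -/

section Limit

variable {K : Type*} [NormedAddCommGroup K] [InnerProductSpace ℂ K]

theorem WeaklyTendstoOn.inner_left {D : Submodule ℂ K} {T : ℕ → K →L[ℂ] K} {M : D →ₗ[ℂ] K}
    (hM : WeaklyTendstoOn D T M)
    (hT : ∀ n α β, inner ℂ (T n α) β = inner ℂ α (T n β)) (α β : D) :
    inner ℂ (M α) (β : K) = inner ℂ (α : K) (M β) := by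
  refine tendsto_nhds_unique (hM α β) ?_
  have h := (RCLike.continuous_conj.tendsto _).comp (hM β α)
  rw [inner_conj_symm] at h
  refine h.congr fun n => ?_
  simp [hT n α β]

/-- If `A` and `B` preserve `D`, and the difference of `B† * T n * A` and `T n` tends weakly to zero
on `D`, then the weak limit `M` of `T n` satisfies `M * A = B' * M` for the inverse `B'` of `B†`. -/
theorem WeaklyTendstoOn.apply_eq {D : Submodule ℂ K} (hD : Dense (D : Set K))
    {T T' : ℕ → K →L[ℂ] K} {M : D →ₗ[ℂ] K} (hM : WeaklyTendstoOn D T M)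
    (h0 : WeaklyTendstoZeroOn D fun n => T' n - T n) {A B B' : K →L[ℂ] K}
    (hA : ∀ α ∈ D, A α ∈ D) (hB : ∀ α ∈ D, B α ∈ D)
    (hT : ∀ n α β, inner ℂ (T' n α) β = inner ℂ (T n (A α)) (B β))
    (hBB' : ∀ α β, inner ℂ (B' α) (B β) = inner ℂ α β) (hsurj : ∀ α ∈ D, ∃ β ∈ D, B β = α)
    (α : D) : M ⟨A α, hA α α.2⟩ = B' (M α) := by
  -- Only pairings with `D` are controlled in the limit; density and `B D = D` make testing against
  -- vectors `B β` sufficient.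
  refine hD.eq_of_inner_left (𝕜 := ℂ) fun γ hγ => ?_
  obtain ⟨β, hβ, rfl⟩ := hsurj γ hγ
  rw [hBB']
  refine tendsto_nhds_unique (hM ⟨A α, hA α α.2⟩ ⟨B β, hB β hβ⟩) ?_
  have h := (h0 α α.2 β hβ).add (hM α ⟨β, hβ⟩)
  rw [zero_add] at h
  refine h.congr fun n => ?_
  simp [hT]

end Limit

/-! ### Symmetric intertwiners are multiples of the flip. -/

section Intertwining

variable {G H : Type*} [Group G] [TopologicalSpace G]
  [NormedAddCommGroup H] [InnerProductSpace ℂ H] [CompleteSpace H] (π : UnitaryRep G H)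

/-- The pairs `(g, h)` such that `M (π(g) ⊗ π(h)) = (π(h) ⊗ π(g)) M`. -/
def flipIntertwining (D : Submodule ℂ (HilbertTensor H))
    (hDinv : ∀ g h : G, ∀ α ∈ D, π.op₂ g h α ∈ D) (M : D →ₗ[ℂ] HilbertTensor H) :
    Subgroup (G × G) where
  carrier := {p | ∀ α : D, M ⟨π.op₂ p.1 p.2 α, hDinv _ _ _ α.2⟩ = π.op₂ p.2 p.1 (M α)}
  one_mem' α := by simp [π.op₂_one_one]
  mul_mem' {p q} hp hq α := by
    have h := hp ⟨π.op₂ q.1 q.2 α, hDinv _ _ _ α.2⟩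
    rw [hq α] at h
    simpa [π.op₂_op₂] using h
  inv_mem' {p} hp α := by
    have h := hp ⟨π.op₂ p.1⁻¹ p.2⁻¹ α, hDinv _ _ _ α.2⟩
    simp only [π.op₂_op₂, mul_inv_cancel, π.op₂_one_one] at h
    simp [h, π.op₂_op₂, π.op₂_one_one]

variable {π}

/-- A symmetric densely defined operator which intertwines `π(g) ⊗ π(h)` with `π(h) ⊗ π(g)`, for an
irreducible `π`, is a multiple of the flip. -/
theorem UnitaryRep.IsIrreducible.exists_eq_smul_flip (hπ : π.IsIrreducible)
    {D : Submodule ℂ (HilbertTensor H)} (hD : Dense (D : Set (HilbertTensor H)))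
    (hDinv : ∀ g h : G, ∀ α ∈ D, π.op₂ g h α ∈ D) {M : D →ₗ[ℂ] HilbertTensor H}
    (hsymm : ∀ α β : D,
      inner ℂ (M α) (β : HilbertTensor H) = inner ℂ (α : HilbertTensor H) (M β))
    (hM : ∀ g h, ∀ α : D, M ⟨π.op₂ g h α, hDinv g h α α.2⟩ = π.op₂ h g (M α)) :
    ∃ c : ℂ, ∀ α : D, M α = c • flip H α := by
  -- The graph of `FM*`, closed with no closability argument because it is cut out by continuous
  -- equations.
  let Γ : Submodule ℂ (WithLp 2 (HilbertTensor H × HilbertTensor H)) :=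
    { carrier := {z | ∀ β : D, inner ℂ (flip H z.snd) (β : HilbertTensor H) = inner ℂ z.fst (M β)}
      zero_mem' := fun β => by simp
      add_mem' := fun hx hy β => by
        simp only [WithLp.add_fst, WithLp.add_snd, map_add, inner_add_left, hx β, hy β]
      smul_mem' := fun c x hx β => by
        simp only [WithLp.smul_fst, WithLp.smul_snd, map_smul, inner_smul_left, hx β] }
  have hΓ : IsClosed (Γ : Set (WithLp 2 (HilbertTensor H × HilbertTensor H))) := by
    have h : (Γ : Set (WithLp 2 (HilbertTensor H × HilbertTensor H))) = ⋂ β : D,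
        {z | inner ℂ (flip H z.snd) (β : HilbertTensor H) = inner ℂ z.fst (M β)} := by
      ext z
      simp [Γ]
    rw [h]
    refine isClosed_iInter fun β => isClosed_eq ?_ ?_
    · exact ((flip H).continuous.comp (WithLp.sndL 2 ℂ _ _).continuous).inner continuous_const
    · exact (WithLp.fstL 2 ℂ _ _).continuous.inner continuous_const
  obtain ⟨c, hc⟩ := exists_eq_smul_of_mem_graph (fun p : G × G => π.op₂ p.1 p.2)
    (fun p => ⟨p⁻¹, π.star_op₂ _ _⟩) hπ.exists_eq_smul_one_op₂ Γ hΓ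
    (fun p x y h β => by
      have h1 := h ⟨π.op₂ p.2⁻¹ p.1⁻¹ β, hDinv _ _ _ β.2⟩
      rw [hM] at h1
      simpa [π.flip_op₂, π.inner_op₂_left] using h1)
    (fun y h => by
      have h1 : flip H y = 0 := hD.eq_of_inner_left (𝕜 := ℂ) fun β hβ => by
        simpa using h ⟨β, hβ⟩
      rw [← flip_flip y, h1, map_zero])
  refine ⟨c, fun α => ?_⟩
  -- Symmetry of `M` puts `(α, FMα)` in `Γ`.
  have h := hc α (flip H (M α)) fun β => by simpa [flip_flip] using hsymm α β
  rw [← flip_flip (M α), h, map_smul]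

end Intertwining

end FlipLimit

end

/-! ### From the generating set to the conclusion. -/

theorem proposition4p2
    {G H : Type*} [Group G] [TopologicalSpace G] [IsTopologicalGroup G]
    [LocallyCompactSpace G] [T2Space G] [MeasurableSpace G] [BorelSpace G]
    [NormedAddCommGroup H] [InnerProductSpace ℂ H] [CompleteSpace H]
    (π : FlipLimit.UnitaryRep G H) (hπ : π.IsIrreducible)
    (S : Set G) (hS : Subgroup.closure S = ⊤)
    (μ : ℕ → Measure G) [∀ n, IsFiniteMeasure (μ n)] [∀ n, (μ n).Regular]
    (hμ : ∀ n, FlipLimit.IsSymmetric (μ n))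
    (D : Submodule ℂ (FlipLimit.HilbertTensor H))
    (hD : Dense (D : Set (FlipLimit.HilbertTensor H)))
    (hDinv : ∀ g h : G, ∀ α ∈ D, π.op₂ g h α ∈ D)
    (M : D →ₗ[ℂ] FlipLimit.HilbertTensor H)
    (hM : FlipLimit.WeaklyTendstoOn D (fun n => π.average (μ n)) M)
    (hleft : ∀ s ∈ S, FlipLimit.WeaklyTendstoZeroOn D
      (fun n => π.average (FlipLimit.leftTranslate (μ n) s) - π.average (μ n)))
    (hright : ∀ s ∈ S, FlipLimit.WeaklyTendstoZeroOn D
      (fun n => π.average (FlipLimit.rightTranslate (μ n) s) - π.average (μ n))) :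
    -- `M` is bounded
    (∃ C : ℝ, ∀ α : D, ‖M α‖ ≤ C * ‖α‖) ∧
    ∃ c : ℂ,
      -- the unique continuous extension of `M` is `c • F`
      (∀ T : FlipLimit.HilbertTensor H →L[ℂ] FlipLimit.HilbertTensor H,
        (∀ α : D, T α = M α) ↔ T = c • FlipLimit.flip H) ∧
      -- weak convergence to `c • F` on `D`
      (∀ α ∈ D, ∀ β ∈ D, Tendsto (fun n => inner ℂ (π.average (μ n) α) β) atTop
        (𝓝 (inner ℂ (c • FlipLimit.flip H α) β))) ∧
      -- asymptotic orthogonality of matrix coefficients; `inner ℂ x y` is linear in `y`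
      (∀ v w v' w' : H, FlipLimit.htmul w' v ∈ D → FlipLimit.htmul v' w ∈ D →
        Tendsto (fun n => ∫ g, inner ℂ w (π.op g v) * conj (inner ℂ w' (π.op g v')) ∂(μ n)) atTop
          (𝓝 (c * (inner ℂ v' v * conj (inner ℂ w' w))))) := by
  have hint : FlipLimit.flipIntertwining π D hDinv M = ⊤ := by
    set L := FlipLimit.flipIntertwining π D hDinv M
    have hr : L.comap (MonoidHom.inr G G) = ⊤ := by
      rw [eq_top_iff, ← hS, Subgroup.closure_le]
      intro s hs α
      exact hM.apply_eq hD (hleft s hs) (hDinv 1 s) (hDinv s 1)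
        (fun n => FlipLimit.inner_average_leftTranslate π (μ n) s)
        (fun α β => by simp [π.inner_op₂_left, π.op₂_op₂, π.op₂_one_one])
        (fun α hα => ⟨_, hDinv s⁻¹ 1 α hα, by simp [π.op₂_op₂, π.op₂_one_one]⟩) α
    have hl : L.comap (MonoidHom.inl G G) = ⊤ := by
      rw [eq_top_iff, ← hS, Subgroup.closure_le]
      intro s hs
      -- Right translation by `s` yields the intertwining relation for `(s⁻¹, 1)`.
      rw [SetLike.mem_coe, ← inv_mem_iff]
      intro α
      exact hM.apply_eq hD (hright s hs) (hDinv s⁻¹ 1) (hDinv 1 s⁻¹)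
        (fun n => FlipLimit.inner_average_rightTranslate π (μ n) s)
        (fun α β => by simp [π.inner_op₂_left, π.op₂_op₂, π.op₂_one_one])
        (fun α hα => ⟨_, hDinv 1 s α hα, by simp [π.op₂_op₂, π.op₂_one_one]⟩) α
    refine eq_top_iff.2 fun p _ => ?_
    have h1 : MonoidHom.inl G G p.1 ∈ L := Subgroup.mem_comap.1 (hl ▸ Subgroup.mem_top p.1)
    have h2 : MonoidHom.inr G G p.2 ∈ L := Subgroup.mem_comap.1 (hr ▸ Subgroup.mem_top p.2)
    simpa using L.mul_mem h1 h2
  obtain ⟨c, hc⟩ := hπ.exists_eq_smul_flip hD hDinv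
    (hM.inner_left fun n => FlipLimit.inner_average_left π (hμ n))
    (fun g h => by
      have : (g, h) ∈ FlipLimit.flipIntertwining π D hDinv M := hint ▸ Subgroup.mem_top _
      exact this)
  have hlim : ∀ α ∈ D, ∀ β ∈ D, Tendsto (fun n => inner ℂ (π.average (μ n) α) β) atTop
      (𝓝 (inner ℂ (c • FlipLimit.flip H α) β)) := fun α hα β hβ =>
    hc ⟨α, hα⟩ ▸ hM ⟨α, hα⟩ ⟨β, hβ⟩
  refine ⟨⟨‖c • FlipLimit.flip H‖, fun α => ?_⟩, c, fun T => ⟨fun hT => ?_, ?_⟩, hlim, ?_⟩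
  · rw [hc]
    exact (c • FlipLimit.flip H).le_opNorm α
  · exact DFunLike.coe_injective (Continuous.ext_on hD T.continuous (c • FlipLimit.flip H).continuous
      fun α hα => (hT ⟨α, hα⟩).trans (hc ⟨α, hα⟩))
  · rintro rfl α
    exact (hc α).symm
  · intro v w v' w' h1 h2
    have h := (RCLike.continuous_conj.tendsto _).comp (hlim _ h1 _ h2)
    rw [FlipLimit.flip_htmul, inner_smul_left, FlipLimit.inner_htmul, map_mul, map_mul,
      Complex.conj_conj, inner_conj_symm] at h
    exact h.congr fun n => (FlipLimit.integral_inner_mul_conj_inner π (hμ n) v w v' w').symm
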